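/- Let $(\Omega,\mu)$ be a $\sigma$-finite measure space with $\mu$ non-atomic, and let $\mathcal M(\Omega,\mu)$ be the space of (a.e. classes of) $\mu$-measurable scalar functions, real or complex. For $f\in\mathcal M(\Omega,\mu)$ let $f^*(t)=\inf\{\lambda\ge 0:\mu\{|f|>\lambda\}\le t\}$ be its non-increasing rearrangement and $f^{**}(t)=\frac1t\int_0^t f^*(u)\,du$, $t>0$. Let $L_{1,\infty}$ have the quasi-norm $\sup_{t>0}t f^*(t)$. A positive Lebesgue measurable function $b$ on $(0,\infty)$ is slowly varying, $b\in SV$, if for every $\varepsilon>0$ the function $t^{\varepsilon}b(t)$ is equivalent to an increasing function and $t^{-\varepsilon}b(t)$ is equivalent to a decreasing function (two positive functions are equivalent if each is at most a constant times the other). Write $\|\cdot\|_{q,I}$ for the (quasi-)norm of $L_q(I)$ on an interval $I\subset(0,\infty)$, with $1/\infty=0$. Given $\gamma\in\mathbb R$, $0<q,r,s\le\infty$, $a,b,c\in SV$ and a measurable $g:(0,\infty)\to[0,\infty]$, put $$N^{\mathcal{LL}}_\gamma(g)=\Big\|t^{-\frac1s}c(t)\big\|u^{-\frac1r}b(u)\|v^{\gamma-\frac1q}a(v)g(v)\|_{q,(0,u)}\big\|_{r,(0,t)}\Big\|_{s,(0,\infty)},$$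 $$N^{\mathcal{RR}}_\gamma(g)=\Big\|t^{-\frac1s}c(t)\big\|u^{-\frac1r}b(u)\|v^{\gamma-\frac1q}a(v)g(v)\|_{q,(u,\infty)}\big\|_{r,(t,\infty)}\Big\|_{s,(0,\infty)}.$$ Let $K(t,f;A_0,A_1)=\inf\{\|f_0\|_{A_0}+t\|f_1\|_{A_1}: f=f_0+f_1,\ f_i\in A_i\}$ be Peetre's $K$-functional. For $X\in\{\mathcal{LL},\mathcal{RR}\}$, let $(A_0,A_1)^{X}_{\theta,s,c,r,b,q,a}$ be the space of all $f\in A_0+A_1$ with $\|f\|:=N^{X}_{-\theta}(K(\cdot,f;A_0,A_1))<\infty$, let $L^{X}_{p,(s,c,r,b,q,a)}$ be the space of all $f\in\mathcal M(\Omega,\mu)$ with $\|f\|:=N^{X}_{1/p}(f^*)<\infty$, and let $(L)^{X}_{p,(s,c,r,b,q,a)}$ be the space of all $f\in\mathcal M(\Omega,\mu)$ with $\|f\|:=N^{X}_{1/p}(f^{**})<\infty$. **Theorem.** Let $0<\theta\le1$, $p=\frac1{1-\theta}$ (so $p=\infty$ if $\theta=1$), $0<q,r,s\le\infty$ and $a,b,c\in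 SV$. Then $$(L_1,L_\infty)^{\mathcal{LL}}_{\theta,s,c,r,b,q,a}=(L_{1,\infty},L_\infty)^{\mathcal{LL}}_{\theta,s,c,r,b,q,a}=(L)^{\mathcal{LL}}_{p,(s,c,r,b,q,a)}=L^{\mathcal{LL}}_{p,(s,c,r,b,q,a)}$$ and $$(L_1,L_\infty)^{\mathcal{RR}}_{\theta,s,c,r,b,q,a}=(L_{1,\infty},L_\infty)^{\mathcal{RR}}_{\theta,s,c,r,b,q,a}=(L)^{\mathcal{RR}}_{p,(s,c,r,b,q,a)}=L^{\mathcal{RR}}_{p,(s,c,r,b,q,a)},$$ where equality means that the spaces have the same elements and that their quasi-norms are equivalent (each is at most a constant, independent of $f$, times the other). -/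

import Mathlib

open MeasureTheory Set
open scoped ENNReal NNReal

namespace LorentzKaramata

noncomputable section

/-- Slowly varying functions on `(0,∞)`: positive, Lebesgue measurable, and for every `ε > 0` the
function `t ^ ε * b t` is equivalent to an increasing function on `(0,∞)` and `t ^ (-ε) * b t` is
equivalent to a decreasing one. Values outside `(0,∞)` are irrelevant. -/
structure SlowlyVarying (b : ℝ → ℝ) : Prop where
  pos : ∀ t, 0 < t → 0 < b t
  measurable : AEMeasurable b (volume.restrict (Ioi 0))
  equiv_increasing : ∀ ε : ℝ, 0 < ε → ∃ g : ℝ → ℝ, MonotoneOn g (Ioi 0) ∧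
    ∃ C : ℝ, 0 < C ∧ ∀ t, 0 < t → g t ≤ C * (t ^ ε * b t) ∧ t ^ ε * b t ≤ C * g t
  equiv_decreasing : ∀ ε : ℝ, 0 < ε → ∃ g : ℝ → ℝ, AntitoneOn g (Ioi 0) ∧
    ∃ C : ℝ, 0 < C ∧ ∀ t, 0 < t → g t ≤ C * (t ^ (-ε) * b t) ∧ t ^ (-ε) * b t ≤ C * g t

/-- `μ` has no atoms, in the measure-theoretic sense: every measurable set of positive measure has
a measurable subset of positive, strictly smaller measure. -/
def Nonatomic {Ω : Type*} [MeasurableSpace Ω] (μ : Measure Ω) : Prop :=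
  ∀ s, MeasurableSet s → 0 < μ s → ∃ t, t ⊆ s ∧ MeasurableSet t ∧ 0 < μ t ∧ μ t < μ s

/-- The weighted (quasi-)norm `‖t ^ (γ - 1/q) b(t) g(t)‖_{q, I}` of the Lebesgue space `L_q(I)`,
`I ⊆ (0,∞)`, `0 < q ≤ ∞`, with `1/∞ = 0`. -/
def weightedNorm (γ : ℝ) (b : ℝ → ℝ) (q : ℝ≥0∞) (I : Set ℝ) (g : ℝ → ℝ≥0∞) : ℝ≥0∞ :=
  eLpNorm (fun t => ENNReal.ofReal (t ^ (γ - (q⁻¹).toReal) * b t) * g t) q (volume.restrict I)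

/-- `‖t^{-1/s} c(t) ‖u^{-1/r} b(u) ‖v^{γ-1/q} a(v) g(v)‖_{q,(0,u)}‖_{r,(0,t)}‖_{s,(0,∞)}`. -/
def normLL (γ : ℝ) (s : ℝ≥0∞) (c : ℝ → ℝ) (r : ℝ≥0∞) (b : ℝ → ℝ) (q : ℝ≥0∞) (a : ℝ → ℝ)
    (g : ℝ → ℝ≥0∞) : ℝ≥0∞ :=
  weightedNorm 0 c s (Ioi 0) fun t =>
    weightedNorm 0 b r (Ioo 0 t) fun u => weightedNorm γ a q (Ioo 0 u) g

/-- `‖t^{-1/s} c(t) ‖u^{-1/r} b(u) ‖v^{γ-1/q} a(v) g(v)‖_{q,(u,∞)}‖_{r,(t,∞)}‖_{s,(0,∞)}`. -/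
def normRR (γ : ℝ) (s : ℝ≥0∞) (c : ℝ → ℝ) (r : ℝ≥0∞) (b : ℝ → ℝ) (q : ℝ≥0∞) (a : ℝ → ℝ)
    (g : ℝ → ℝ≥0∞) : ℝ≥0∞ :=
  weightedNorm 0 c s (Ioi 0) fun t =>
    weightedNorm 0 b r (Ioi t) fun u => weightedNorm γ a q (Ioi u) g

/-- A (quasi-)normed space of elements of `E`: its set of elements together with its (quasi-)norm
(only the values on the elements matter). -/
structure Space (E : Type*) where
  elements : Set E
  qnorm : E → ℝ≥0∞

/-- Continuous embedding `X ⊂ Y`. -/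
def Space.Embeds {E : Type*} (X Y : Space E) : Prop :=
  X.elements ⊆ Y.elements ∧ ∃ C : ℝ≥0, ∀ f ∈ X.elements, Y.qnorm f ≤ C * X.qnorm f

/-- Equality of (quasi-)normed spaces: the same elements and equivalent (quasi-)norms. -/
def Space.Same {E : Type*} (X Y : Space E) : Prop :=
  X.Embeds Y ∧ Y.Embeds X

/-- The space of all elements of `E` at which the functional `N` is finite. -/
def Space.ofFunctional {E : Type*} (N : E → ℝ≥0∞) : Space E where
  elements := {f | N f < ∞}
  qnorm := N

section Interpolation

variable {E : Type*} [AddCommGroup E]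

/-- The elements of `A₀ + A₁`. -/
def sumElements (A₀ A₁ : Space E) : Set E :=
  {f | ∃ f₀ ∈ A₀.elements, ∃ f₁ ∈ A₁.elements, f = f₀ + f₁}

/-- Peetre's `K`-functional `K(t, f; A₀, A₁)`, `t > 0`. -/
def peetreK (A₀ A₁ : Space E) (f : E) (t : ℝ) : ℝ≥0∞ :=
  ⨅ (f₀ : E) (_ : f₀ ∈ A₀.elements) (f₁ : E) (_ : f₁ ∈ A₁.elements) (_ : f = f₀ + f₁),
    A₀.qnorm f₀ + ENNReal.ofReal t * A₁.qnorm f₁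

/-- The extremal interpolation space `(A₀, A₁)^{𝓛,𝓛}_{θ,s,c,r,b,q,a}`. -/
def interpLL (A₀ A₁ : Space E) (θ : ℝ) (s : ℝ≥0∞) (c : ℝ → ℝ) (r : ℝ≥0∞) (b : ℝ → ℝ)
    (q : ℝ≥0∞) (a : ℝ → ℝ) : Space E where
  elements := {f | f ∈ sumElements A₀ A₁ ∧ normLL (-θ) s c r b q a (peetreK A₀ A₁ f) < ∞}
  qnorm f := normLL (-θ) s c r b q a (peetreK A₀ A₁ f)

/-- The extremal interpolation space `(A₀, A₁)^{𝓡,𝓡}_{θ,s,c,r,b,q,a}`. -/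
def interpRR (A₀ A₁ : Space E) (θ : ℝ) (s : ℝ≥0∞) (c : ℝ → ℝ) (r : ℝ≥0∞) (b : ℝ → ℝ)
    (q : ℝ≥0∞) (a : ℝ → ℝ) : Space E where
  elements := {f | f ∈ sumElements A₀ A₁ ∧ normRR (-θ) s c r b q a (peetreK A₀ A₁ f) < ∞}
  qnorm f := normRR (-θ) s c r b q a (peetreK A₀ A₁ f)

end Interpolation

section FunctionSpaces

variable {Ω : Type*} [MeasurableSpace Ω] {μ : Measure Ω} {𝕜 : Type*} [RCLike 𝕜]

/-- Non-increasing rearrangement `f*(t) = inf {λ ≥ 0 : μ {|f| > λ} ≤ t}`, `inf ∅ = ∞`. -/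
def rearrangement (f : Ω →ₘ[μ] 𝕜) (t : ℝ) : ℝ≥0∞ :=
  sInf {l : ℝ≥0∞ | μ {x | l < ‖f x‖ₑ} ≤ ENNReal.ofReal t}

/-- Maximal function `f**(t) = t⁻¹ ∫₀ᵗ f*(u) du`, `t > 0`. -/
def maximalRearrangement (f : Ω →ₘ[μ] 𝕜) (t : ℝ) : ℝ≥0∞ :=
  (ENNReal.ofReal t)⁻¹ * ∫⁻ u in Ioo 0 t, rearrangement f u

variable (μ 𝕜)

/-- The Lebesgue space `L_p(Ω, μ)`. -/
def lebesgueSpace (p : ℝ≥0∞) : Space (Ω →ₘ[μ] 𝕜) :=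
  Space.ofFunctional fun f => eLpNorm f p μ

/-- The weak space `L_{1,∞}(Ω, μ)`, with quasi-norm `sup_{t>0} t f*(t)`. -/
def weakL1 : Space (Ω →ₘ[μ] 𝕜) :=
  Space.ofFunctional fun f => ⨆ (t : ℝ) (_ : 0 < t), ENNReal.ofReal t * rearrangement f t

/-- `L^{𝓛,𝓛}_{p,(s,c,r,b,q,a)}`, defined through `f*`. -/
def lorentzLL (p s : ℝ≥0∞) (c : ℝ → ℝ) (r : ℝ≥0∞) (b : ℝ → ℝ) (q : ℝ≥0∞) (a : ℝ → ℝ) :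
    Space (Ω →ₘ[μ] 𝕜) :=
  Space.ofFunctional fun f => normLL (p⁻¹).toReal s c r b q a (rearrangement f)

/-- `(L)^{𝓛,𝓛}_{p,(s,c,r,b,q,a)}`, defined through `f**`. -/
def lorentzMaxLL (p s : ℝ≥0∞) (c : ℝ → ℝ) (r : ℝ≥0∞) (b : ℝ → ℝ) (q : ℝ≥0∞) (a : ℝ → ℝ) :
    Space (Ω →ₘ[μ] 𝕜) :=
  Space.ofFunctional fun f => normLL (p⁻¹).toReal s c r b q a (maximalRearrangement f)

/-- `L^{𝓡,𝓡}_{p,(s,c,r,b,q,a)}`, defined through `f*`. -/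
def lorentzRR (p s : ℝ≥0∞) (c : ℝ → ℝ) (r : ℝ≥0∞) (b : ℝ → ℝ) (q : ℝ≥0∞) (a : ℝ → ℝ) :
    Space (Ω →ₘ[μ] 𝕜) :=
  Space.ofFunctional fun f => normRR (p⁻¹).toReal s c r b q a (rearrangement f)

/-- `(L)^{𝓡,𝓡}_{p,(s,c,r,b,q,a)}`, defined through `f**`. -/
def lorentzMaxRR (p s : ℝ≥0∞) (c : ℝ → ℝ) (r : ℝ≥0∞) (b : ℝ → ℝ) (q : ℝ≥0∞) (a : ℝ → ℝ) :
    Space (Ω →ₘ[μ] 𝕜) :=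
  Space.ofFunctional fun f => normRR (p⁻¹).toReal s c r b q a (maximalRearrangement f)

end FunctionSpaces

end

end LorentzKaramata

/-!
Cutting `f` at the height `f*(t)` gives `K(t, f; L₁, L_∞) ≤ 2 t f**(t)`, while
`t f*(t) ≤ K(t, f; L_{1,∞}, L_∞)` because adding `f₁` raises the rearrangement by at most
`‖f₁‖_∞`. Since `L₁ ⊆ L_{1,∞}`, all four quasi-norms are equivalent as soon as Hardy's inequality
`N(∫₀ᵗ f*) ≲ N(t f*(t))` holds.

That inequality is true for every lattice quasi-norm `N` with the Fatou property and negative upper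
Boyd index: split `∫₀ᵗ` into the geometric pieces `(lᵏ⁺¹ t, lᵏ t]`; for small `l` the decay of `N`
under dilation by `lᵏ` beats the `k`-th power of the quasi-triangle constant. The nested norms
`N_{-θ}` with slowly varying weights have upper Boyd index at most `-θ`.
-/

namespace LorentzKaramata

theorem eLpNorm_iSup_le {α : Type*} [MeasurableSpace α] {μ : Measure α} {q : ℝ≥0∞}
    {F : ℕ → α → ℝ≥0∞} (hF : ∀ n, AEMeasurable (F n) μ) (hmono : Monotone F) :
    eLpNorm (fun x => ⨆ n, F n x) q μ ≤ ⨆ n, eLpNorm (F n) q μ := by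
  rcases eq_or_ne q 0 with rfl | hq₀
  · simp
  rcases eq_or_ne q ∞ with rfl | hq
  · simp only [eLpNorm_exponent_top]
    refine eLpNormEssSup_le_of_ae_enorm_bound ?_
    filter_upwards [ae_all_iff.2 fun n => enorm_ae_le_eLpNormEssSup (F n) μ] with x hx
    exact iSup_mono hx
  · have hr : 0 < q.toReal := ENNReal.toReal_pos hq₀ hq
    have hpow : ∀ x, (⨆ n, F n x) ^ q.toReal = ⨆ n, F n x ^ q.toReal := fun x =>
      (ENNReal.orderIsoRpow q.toReal hr).map_iSup fun n => F n x
    simp only [eLpNorm_eq_lintegral_rpow_enorm_toReal hq₀ hq, enorm_eq_self, hpow]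
    rw [lintegral_iSup' (fun n => (hF n).pow_const _) (ae_of_all _ fun x m n hmn =>
      ENNReal.rpow_le_rpow (hmono hmn x) hr.le)]
    exact ((ENNReal.orderIsoRpow _ (one_div_pos.2 hr)).map_iSup _).le

theorem eLpNorm_comp_mul_left {l : ℝ} (hl : 0 < l) (q : ℝ≥0∞) {I : Set ℝ} (hI : MeasurableSet I)
    (F : ℝ → ℝ≥0∞) :
    eLpNorm (fun t => F (l * t)) q (volume.restrict ((l * ·) ⁻¹' I))
      = ENNReal.ofReal (l ^ (-(q⁻¹).toReal)) * eLpNorm F q (volume.restrict I) := by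
  have hemb : MeasurableEmbedding (l * · : ℝ → ℝ) := measurableEmbedding_mulLeft₀ hl.ne'
  change eLpNorm (F ∘ (l * ·)) q _ = _
  rw [← hemb.eLpNorm_map_measure, ← Measure.restrict_map hemb.measurable hI,
    Real.map_volume_mul_left hl.ne', Measure.restrict_smul,
    eLpNorm_smul_measure_of_ne_zero (by simpa using hl.ne'), smul_eq_mul,
    abs_of_pos (inv_pos.2 hl), ENNReal.ofReal_rpow_of_pos (inv_pos.2 hl), Real.inv_rpow hl.le,
    ← Real.rpow_neg hl.le]
  simp only [one_div, ENNReal.toReal_inv]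

theorem SlowlyVarying.exists_le_rpow_mul {b : ℝ → ℝ} (hb : SlowlyVarying b) {ε : ℝ}
    (hε : 0 < ε) :
    ∃ C : ℝ≥0, ∀ l, 0 < l → l ≤ 1 → ∀ t, 0 < t → b t ≤ C * l ^ (-ε) * b (l * t) := by
  obtain ⟨g, hg, C, hC, h⟩ := hb.equiv_decreasing ε hε
  refine ⟨⟨C * C, by positivity⟩, fun l hl hl1 t ht => ?_⟩
  have hlt : 0 < l * t := mul_pos hl ht
  refine le_of_mul_le_mul_left ?_ (Real.rpow_pos_of_pos ht (-ε))
  calc t ^ (-ε) * b t ≤ C * g t := (h t ht).2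
    _ ≤ C * g (l * t) := by gcongr; exact hg hlt ht (mul_le_of_le_one_left ht.le hl1)
    _ ≤ C * (C * ((l * t) ^ (-ε) * b (l * t))) := by gcongr; exact (h _ hlt).1
    _ = t ^ (-ε) * (C * C * l ^ (-ε) * b (l * t)) := by rw [Real.mul_rpow hl.le ht.le]; ring

section WeightedNorm

variable {γ : ℝ} {b : ℝ → ℝ} {q : ℝ≥0∞} {I J : Set ℝ} {g h : ℝ → ℝ≥0∞}

theorem weightedNorm_mono (hI : MeasurableSet I) (hgh : ∀ t ∈ I, g t ≤ h t) :
    weightedNorm γ b q I g ≤ weightedNorm γ b q I h := by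
  refine eLpNorm_mono_enorm_ae ?_
  filter_upwards [ae_restrict_mem hI] with t ht
  simp only [enorm_eq_self]
  gcongr
  exact hgh t ht

theorem weightedNorm_mono_set (hIJ : I ⊆ J) (g : ℝ → ℝ≥0∞) :
    weightedNorm γ b q I g ≤ weightedNorm γ b q J g :=
  eLpNorm_mono_measure _ (Measure.restrict_mono_set _ hIJ)

theorem weightedNorm_const_mul_le (C : ℝ≥0) (g : ℝ → ℝ≥0∞) :
    weightedNorm γ b q I (fun t => C * g t) ≤ C * weightedNorm γ b q I g :=
  eLpNorm_le_mul_eLpNorm_of_ae_le_mul' (ae_of_all _ fun _ => (mul_left_comm _ _ _).le) q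

theorem weightedNorm_congr (hI : MeasurableSet I) (hgh : ∀ t ∈ I, g t = h t) :
    weightedNorm γ b q I g = weightedNorm γ b q I h :=
  le_antisymm (weightedNorm_mono hI fun t ht => (hgh t ht).le)
    (weightedNorm_mono hI fun t ht => (hgh t ht).ge)

theorem weightedNorm_ofReal_mul (hI : MeasurableSet I) (hI₀ : I ⊆ Ioi 0) (g : ℝ → ℝ≥0∞) :
    weightedNorm γ b q I (fun t => ENNReal.ofReal t * g t) = weightedNorm (γ + 1) b q I g := by
  refine eLpNorm_congr_ae ?_
  filter_upwards [ae_restrict_mem hI] with t ht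
  have ht₀ : 0 < t := hI₀ ht
  rw [← mul_assoc, ← ENNReal.ofReal_mul' ht₀.le, add_sub_right_comm, Real.rpow_add_one ht₀.ne',
    mul_right_comm]

theorem aemeasurable_weight_mul (hb : AEMeasurable b (volume.restrict (Ioi 0)))
    (hI : I ⊆ Ioi 0) (hg : Measurable g) :
    AEMeasurable (fun t => ENNReal.ofReal (t ^ γ * b t) * g t) (volume.restrict I) :=
  ((measurable_id.pow_const γ).aemeasurable.mul
    (hb.mono_measure (Measure.restrict_mono_set volume hI))).ennreal_ofReal.mul hg.aemeasurable

theorem weightedNorm_add_le (hb : AEMeasurable b (volume.restrict (Ioi 0))) (hI : I ⊆ Ioi 0)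
    (hg : Measurable g) (hh : Measurable h) :
    weightedNorm γ b q I (fun t => g t + h t)
      ≤ (ENNReal.LpAddConst q).toNNReal * (weightedNorm γ b q I g + weightedNorm γ b q I h) := by
  rw [ENNReal.coe_toNNReal (ENNReal.LpAddConst_lt_top q).ne]
  simp only [weightedNorm, mul_add (ENNReal.ofReal _)]
  exact eLpNorm_add_le' (aemeasurable_weight_mul hb hI hg).aestronglyMeasurable
    (aemeasurable_weight_mul hb hI hh).aestronglyMeasurable q

theorem weightedNorm_iSup_le (hb : AEMeasurable b (volume.restrict (Ioi 0))) (hI : I ⊆ Ioi 0)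
    {F : ℕ → ℝ → ℝ≥0∞} (hF : ∀ n, Measurable (F n)) (hmono : Monotone F) :
    weightedNorm γ b q I (fun t => ⨆ n, F n t) ≤ ⨆ n, weightedNorm γ b q I (F n) := by
  simp only [weightedNorm, ENNReal.mul_iSup]
  exact eLpNorm_iSup_le (fun n => aemeasurable_weight_mul hb hI (hF n))
    fun m n hmn t => mul_le_mul_right (hmono hmn t) _

theorem weightedNorm_top (hq : 0 < q) (hb : ∀ t, 0 < t → 0 < b t) (hI : MeasurableSet I)
    (hI₀ : I ⊆ Ioi 0) (hvol : volume I ≠ 0) :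
    weightedNorm γ b q I (fun _ => ∞) = ∞ := by
  have hweight : ∀ᵐ t ∂volume.restrict I,
      ENNReal.ofReal (t ^ (γ - (q⁻¹).toReal) * b t) * ∞ = ∞ := by
    filter_upwards [ae_restrict_mem hI] with t ht
    exact ENNReal.mul_top
      (ENNReal.ofReal_pos.2 (mul_pos (Real.rpow_pos_of_pos (hI₀ ht) _) (hb t (hI₀ ht)))).ne'
  rw [weightedNorm, eLpNorm_congr_ae hweight, eLpNorm_const _ hq.ne' (by simpa using hvol),
    enorm_eq_self, Measure.restrict_apply_univ]
  refine ENNReal.top_mul fun h => ?_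
  rcases ENNReal.rpow_eq_zero_iff.1 h with ⟨h, -⟩ | ⟨-, h⟩
  · exact hvol h
  · exact h.not_ge (by positivity)

theorem weightedNorm_comp_mul_le {l M : ℝ} (hl : 0 < l) (hM : 0 ≤ M)
    (hb : ∀ t, 0 < t → b t ≤ M * b (l * t)) (hI : MeasurableSet I) (hI₀ : I ⊆ Ioi 0)
    (g : ℝ → ℝ≥0∞) :
    weightedNorm γ b q ((l * ·) ⁻¹' I) (fun t => g (l * t))
      ≤ ENNReal.ofReal (M * l ^ (-γ)) * weightedNorm γ b q I g := by
  set e := γ - (q⁻¹).toReal with he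
  have hweight : ∀ t, 0 < t → t ^ e * b t ≤ M * l ^ (-e) * ((l * t) ^ e * b (l * t)) :=
    fun t ht => by
    calc t ^ e * b t ≤ t ^ e * (M * b (l * t)) := by gcongr; exact hb t ht
      _ = M * (l ^ (-e) * l ^ e) * (t ^ e * b (l * t)) := by
        rw [← Real.rpow_add hl, neg_add_cancel, Real.rpow_zero]; ring
      _ = _ := by rw [Real.mul_rpow hl.le ht.le]; ring
  calc weightedNorm γ b q ((l * ·) ⁻¹' I) (fun t => g (l * t))
      ≤ ENNReal.ofReal (M * l ^ (-e)) *
        eLpNorm (fun t => ENNReal.ofReal ((l * t) ^ e * b (l * t)) * g (l * t)) q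
          (volume.restrict ((l * ·) ⁻¹' I)) := by
        refine eLpNorm_le_mul_eLpNorm_of_ae_le_mul' (c := (M * l ^ (-e)).toNNReal) ?_ q
        filter_upwards [ae_restrict_mem (measurable_const_mul l hI)] with t ht
        have ht₀ : 0 < t := pos_of_mul_pos_right (hI₀ ht) hl.le
        change _ ≤ ENNReal.ofReal (M * l ^ (-e)) * _
        simp only [enorm_eq_self]
        rw [← mul_assoc, ← ENNReal.ofReal_mul (by positivity)]
        exact mul_le_mul_left (ENNReal.ofReal_le_ofReal (hweight t ht₀)) _
    _ = ENNReal.ofReal (M * l ^ (-e)) *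
        (ENNReal.ofReal (l ^ (-(q⁻¹).toReal)) * weightedNorm γ b q I g) := by
        rw [eLpNorm_comp_mul_left hl q hI fun t => ENNReal.ofReal (t ^ e * b t) * g t,
          weightedNorm]
    _ = ENNReal.ofReal (M * l ^ (-γ)) * weightedNorm γ b q I g := by
        rw [← mul_assoc, ← ENNReal.ofReal_mul (by positivity), mul_assoc M, ← Real.rpow_add hl, he]
        congr 4
        ring

end WeightedNorm

/-- A function quasi-norm with the Fatou property on the non-negative functions on `(0,∞)`: the
axioms of a quasi-Banach function space, in the form stable under iterating `weightedNorm`. -/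
structure IsFunctionQuasinorm (N : (ℝ → ℝ≥0∞) → ℝ≥0∞) : Prop where
  mono : ∀ {g h : ℝ → ℝ≥0∞}, (∀ t, 0 < t → g t ≤ h t) → N g ≤ N h
  const_mul_le : ∀ (C : ℝ≥0) (g : ℝ → ℝ≥0∞), N (fun t => C * g t) ≤ C * N g
  add_le : ∃ K : ℝ≥0, ∀ g h : ℝ → ℝ≥0∞, Measurable g → Measurable h →
    N (fun t => g t + h t) ≤ K * (N g + N h)
  iSup_le : ∀ F : ℕ → ℝ → ℝ≥0∞, (∀ n, Measurable (F n)) → Monotone F →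
    N (fun t => ⨆ n, F n t) ≤ ⨆ n, N (F n)
  top : N (fun _ => ∞) = ∞

/-- The upper Boyd index of `N` is at most `γ`: up to an arbitrarily small loss in the exponent,
the dilation `g ↦ g (l * ·)`, `l ≤ 1`, increases `N` at most by the factor `l ^ (-γ)`. -/
def HasUpperBoydIndexLE (N : (ℝ → ℝ≥0∞) → ℝ≥0∞) (γ : ℝ) : Prop :=
  ∀ ε : ℝ, 0 < ε → ∃ C : ℝ≥0, ∀ l, 0 < l → l ≤ 1 → ∀ g : ℝ → ℝ≥0∞,
    N (fun t => g (l * t)) ≤ C * ENNReal.ofReal (l ^ (-(γ + ε))) * N g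

/-- A dilation-invariant monotone family of subsets of `(0,∞)`, such as the intervals `(0,t)` or
`(t,∞)` over which the inner norms of `normLL` and `normRR` are taken. -/
structure IsDilationFamily (J : ℝ → Set ℝ) : Prop where
  measurableSet : ∀ t, MeasurableSet (J t)
  subset_Ioi : ∀ t, 0 < t → J t ⊆ Ioi 0
  preimage_mul : ∀ l, 0 < l → ∀ t, (l * ·) ⁻¹' J (l * t) = J t
  volume_ne_zero : ∀ t, 0 < t → volume (J t) ≠ 0
  monotone_or_antitone : Monotone J ∨ Antitone J

theorem isDilationFamily_Ioo : IsDilationFamily (Ioo 0) where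
  measurableSet _ := measurableSet_Ioo
  subset_Ioi _ _ := Ioo_subset_Ioi_self
  preimage_mul l hl t := by
    ext x
    simp only [mem_preimage, mem_Ioo, mul_pos_iff_of_pos_left hl, mul_lt_mul_iff_right₀ hl]
  volume_ne_zero t ht := by simpa using ht
  monotone_or_antitone := Or.inl fun _ _ h => Ioo_subset_Ioo_right h

theorem isDilationFamily_Ioi : IsDilationFamily Ioi where
  measurableSet _ := measurableSet_Ioi
  subset_Ioi _ ht := Ioi_subset_Ioi ht.le
  preimage_mul l hl t := by
    ext x
    simp only [mem_preimage, mem_Ioi, mul_lt_mul_iff_right₀ hl]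
  volume_ne_zero t _ := by simp
  monotone_or_antitone := Or.inr fun _ _ h => Ioi_subset_Ioi h

section FunctionQuasinorm

variable {N : (ℝ → ℝ≥0∞) → ℝ≥0∞} {J : ℝ → Set ℝ} {γ δ : ℝ} {b : ℝ → ℝ} {q : ℝ≥0∞}

theorem IsDilationFamily.measurable_weightedNorm (hJ : IsDilationFamily J) (g : ℝ → ℝ≥0∞) :
    Measurable fun u => weightedNorm γ b q (J u) g := by
  rcases hJ.monotone_or_antitone with h | h
  · exact Monotone.measurable fun u v huv => weightedNorm_mono_set (h huv) g
  · exact Antitone.measurable fun u v huv => weightedNorm_mono_set (h huv) g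

theorem isFunctionQuasinorm_weightedNorm (hq : 0 < q) (hb : SlowlyVarying b) :
    IsFunctionQuasinorm (weightedNorm γ b q (Ioi 0)) where
  mono := weightedNorm_mono measurableSet_Ioi
  const_mul_le := weightedNorm_const_mul_le
  add_le := ⟨_, fun _ _ => weightedNorm_add_le hb.measurable subset_rfl⟩
  iSup_le _ := weightedNorm_iSup_le hb.measurable subset_rfl
  top := weightedNorm_top hq hb.pos measurableSet_Ioi subset_rfl (by simp)

theorem IsFunctionQuasinorm.comp_weightedNorm (hN : IsFunctionQuasinorm N)
    (hJ : IsDilationFamily J) (hq : 0 < q) (hb : SlowlyVarying b) :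
    IsFunctionQuasinorm fun g => N fun u => weightedNorm γ b q (J u) g where
  mono hgh := hN.mono fun u hu =>
    weightedNorm_mono (hJ.measurableSet u) fun t ht => hgh t (hJ.subset_Ioi u hu ht)
  const_mul_le C g :=
    (hN.mono fun _ _ => weightedNorm_const_mul_le C g).trans (hN.const_mul_le C _)
  add_le := by
    obtain ⟨K, hK⟩ := hN.add_le
    refine ⟨(ENNReal.LpAddConst q).toNNReal * K, fun g h hg hh => ?_⟩
    refine (hN.mono fun u hu =>
      weightedNorm_add_le hb.measurable (hJ.subset_Ioi u hu) hg hh).trans ?_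
    rw [ENNReal.coe_mul, mul_assoc]
    refine (hN.const_mul_le _ _).trans ?_
    gcongr
    exact hK _ _ (hJ.measurable_weightedNorm g) (hJ.measurable_weightedNorm h)
  iSup_le F hF hmono :=
    (hN.mono fun u hu =>
      weightedNorm_iSup_le hb.measurable (hJ.subset_Ioi u hu) hF hmono).trans <|
    hN.iSup_le _ (fun n => hJ.measurable_weightedNorm (F n)) fun _ _ hmn u =>
      weightedNorm_mono (hJ.measurableSet u) fun t _ => hmono hmn t
  top := eq_top_iff.2 <| hN.top.ge.trans <| hN.mono fun u hu =>
    (weightedNorm_top hq hb.pos (hJ.measurableSet u) (hJ.subset_Ioi u hu)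
      (hJ.volume_ne_zero u hu)).ge

theorem SlowlyVarying.exists_weightedNorm_comp_mul_le (hb : SlowlyVarying b) {ε : ℝ}
    (hε : 0 < ε) :
    ∃ C : ℝ≥0, ∀ l, 0 < l → l ≤ 1 → ∀ I, MeasurableSet I → I ⊆ Ioi 0 → ∀ g : ℝ → ℝ≥0∞,
      weightedNorm γ b q ((l * ·) ⁻¹' I) (fun t => g (l * t))
        ≤ C * ENNReal.ofReal (l ^ (-(γ + ε))) * weightedNorm γ b q I g := by
  obtain ⟨C, hC⟩ := hb.exists_le_rpow_mul hε
  refine ⟨C, fun l hl hl₁ I hI hI₀ g => ?_⟩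
  refine (weightedNorm_comp_mul_le hl (by positivity) (hC l hl hl₁) hI hI₀ g).trans_eq ?_
  rw [mul_assoc (C : ℝ), ← Real.rpow_add hl, ENNReal.ofReal_mul C.coe_nonneg,
    ENNReal.ofReal_coe_nnreal, neg_add_rev]

theorem hasUpperBoydIndexLE_weightedNorm (hb : SlowlyVarying b) :
    HasUpperBoydIndexLE (weightedNorm γ b q (Ioi 0)) γ := by
  intro ε hε
  obtain ⟨C, hC⟩ := hb.exists_weightedNorm_comp_mul_le (γ := γ) (q := q) hε
  refine ⟨C, fun l hl hl₁ g => ?_⟩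
  have hpre : (l * ·) ⁻¹' Ioi (0 : ℝ) = Ioi 0 := by ext x; simp [hl]
  simpa only [hpre] using hC l hl hl₁ (Ioi 0) measurableSet_Ioi subset_rfl g

theorem HasUpperBoydIndexLE.comp_weightedNorm (hN : IsFunctionQuasinorm N)
    (hδ : HasUpperBoydIndexLE N δ) (hJ : IsDilationFamily J) (hb : SlowlyVarying b) :
    HasUpperBoydIndexLE (fun g => N fun u => weightedNorm γ b q (J u) g) (δ + γ) := by
  intro ε hε
  obtain ⟨C, hC⟩ := hδ (ε / 2) (half_pos hε)
  obtain ⟨D, hD⟩ := hb.exists_weightedNorm_comp_mul_le (γ := γ) (q := q) (half_pos hε)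
  refine ⟨C * D, fun l hl hl₁ g => ?_⟩
  set W : ℝ → ℝ≥0∞ := fun u => weightedNorm γ b q (J u) g
  set x : ℝ≥0 := (l ^ (-(γ + ε / 2))).toNNReal
  have hinner : ∀ u, 0 < u →
      weightedNorm γ b q (J u) (fun t => g (l * t)) ≤ (D * x : ℝ≥0) * W (l * u) := fun u hu => by
    rw [← hJ.preimage_mul l hl u, ENNReal.coe_mul]
    exact hD l hl hl₁ _ (hJ.measurableSet _) (hJ.subset_Ioi _ (mul_pos hl hu)) g
  calc N (fun u => weightedNorm γ b q (J u) fun t => g (l * t))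
      ≤ N (fun u => (D * x : ℝ≥0) * W (l * u)) := hN.mono hinner
    _ ≤ (D * x : ℝ≥0) * N (fun u => W (l * u)) := hN.const_mul_le _ _
    _ ≤ (D * x : ℝ≥0) * (C * ENNReal.ofReal (l ^ (-(δ + ε / 2))) * N W) := by
        gcongr; exact hC l hl hl₁ W
    _ = (C * D : ℝ≥0) * (ENNReal.ofReal (l ^ (-(δ + ε / 2))) *
          ENNReal.ofReal (l ^ (-(γ + ε / 2)))) * N W := by
        rw [ENNReal.coe_mul, ENNReal.coe_mul]
        change _ * ENNReal.ofReal (l ^ (-(γ + ε / 2))) * _ = _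
        ring
    _ = (C * D : ℝ≥0) * ENNReal.ofReal (l ^ (-(δ + γ + ε))) * N W := by
        rw [← ENNReal.ofReal_mul (by positivity), ← Real.rpow_add hl]
        congr 4
        ring

theorem IsFunctionQuasinorm.exists_tsum_le (hN : IsFunctionQuasinorm N) :
    ∃ K : ℝ≥0, ∀ F : ℕ → ℝ → ℝ≥0∞, (∀ k, Measurable (F k)) →
      N (fun t => ∑' k, F k t) ≤ ∑' k, (K : ℝ≥0∞) ^ (k + 1) * N (F k) := by
  obtain ⟨K, hK⟩ := hN.add_le
  have hzero : N (fun _ => 0) ≤ 0 := by simpa using hN.const_mul_le 0 fun _ => 0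
  have hsum : ∀ n (F : ℕ → ℝ → ℝ≥0∞), (∀ k, Measurable (F k)) →
      N (fun t => ∑ k ∈ Finset.range n, F k t)
        ≤ ∑ k ∈ Finset.range n, (K : ℝ≥0∞) ^ (k + 1) * N (F k) := by
    intro n
    induction n with
    | zero => intro F _; simpa using hzero
    | succ n ih =>
      intro F hF
      simp only [Finset.sum_range_succ']
      refine (hK _ _ (Finset.measurable_fun_sum _ fun k _ => hF (k + 1)) (hF 0)).trans ?_
      rw [mul_add]
      gcongr
      · refine (mul_le_mul_right (ih _ fun k => hF (k + 1)) _).trans_eq ?_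
        rw [Finset.mul_sum]
        exact Finset.sum_congr rfl fun k _ => by ring
      · simp
  refine ⟨K, fun F hF => ?_⟩
  simp only [ENNReal.tsum_eq_iSup_nat]
  refine (hN.iSup_le _ (fun n => Finset.measurable_fun_sum _ fun k _ => hF k)
    fun m n hmn t => ?_).trans (iSup_mono fun n => hsum n F hF)
  exact Finset.sum_le_sum_of_subset (Finset.range_mono hmn)

theorem IsFunctionQuasinorm.exists_tsum_comp_mul_le (hN : IsFunctionQuasinorm N)
    (hγ : HasUpperBoydIndexLE N γ) (hγ₀ : γ < 0) :
    ∃ l : ℝ, 0 < l ∧ l < 1 ∧ ∃ C : ℝ≥0, ∀ h : ℝ → ℝ≥0∞, Measurable h →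
      N (fun t => ∑' k : ℕ, h (l ^ (k + 1) * t)) ≤ C * N h := by
  obtain ⟨K, hK⟩ := hN.exists_tsum_le
  obtain ⟨C, hC⟩ := hγ (-γ / 2) (by linarith)
  set δ : ℝ := -(γ + -γ / 2) with hδ
  have hδ₀ : 0 < δ := by linarith
  -- A dilation ratio so small that its decay `l ^ δ` beats the quasi-triangle constant `K`.
  obtain ⟨l, hKl, hl, hl₁⟩ : ∃ l : ℝ, K * l ^ δ < 2⁻¹ ∧ 0 < l ∧ l < 1 := by
    have hlim : Filter.Tendsto (fun l : ℝ => K * l ^ δ) (nhdsWithin 0 (Ioi 0)) (nhds 0) := by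
      have := (Real.continuousAt_rpow_const 0 δ (Or.inr hδ₀.le)).const_mul (K : ℝ)
      simpa [ContinuousAt, Real.zero_rpow hδ₀.ne'] using this.mono_left nhdsWithin_le_nhds
    exact ((hlim.eventually_lt_const (by norm_num)).and (Ioo_mem_nhdsGT one_pos)).exists
  have hx : (K : ℝ≥0∞) * ENNReal.ofReal (l ^ δ) ≤ 2⁻¹ := by
    rw [← ENNReal.ofReal_coe_nnreal, ← ENNReal.ofReal_mul K.coe_nonneg]
    exact (ENNReal.ofReal_le_ofReal hKl.le).trans_eq (by simp [ENNReal.ofReal_inv_of_pos])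
  refine ⟨l, hl, hl₁, C, fun h hh => ?_⟩
  have hterm : ∀ k : ℕ, (K : ℝ≥0∞) ^ (k + 1) * N (fun t => h (l ^ (k + 1) * t))
      ≤ 2⁻¹ ^ (k + 1) * (C * N h) := fun k => by
    calc (K : ℝ≥0∞) ^ (k + 1) * N (fun t => h (l ^ (k + 1) * t))
        ≤ K ^ (k + 1) * (C * ENNReal.ofReal ((l ^ (k + 1)) ^ δ) * N h) := by
          gcongr
          exact hC _ (pow_pos hl _) (pow_le_one₀ hl.le hl₁.le) h
      _ = (K * ENNReal.ofReal (l ^ δ)) ^ (k + 1) * (C * N h) := by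
          rw [← Real.rpow_pow_comm hl.le, ENNReal.ofReal_pow (by positivity)]
          ring
      _ ≤ 2⁻¹ ^ (k + 1) * (C * N h) := by gcongr
  calc N (fun t => ∑' k : ℕ, h (l ^ (k + 1) * t))
      ≤ ∑' k : ℕ, (K : ℝ≥0∞) ^ (k + 1) * N (fun t => h (l ^ (k + 1) * t)) :=
        hK _ fun k => hh.comp (measurable_const_mul _)
    _ ≤ ∑' k : ℕ, 2⁻¹ ^ (k + 1) * (C * N h) := ENNReal.tsum_le_tsum hterm
    _ = C * N h := by
        rw [ENNReal.tsum_mul_right, ENNReal.tsum_geometric_add_one, ENNReal.one_sub_inv_two,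
          inv_inv, ENNReal.inv_mul_cancel two_ne_zero ENNReal.ofNat_ne_top, one_mul]

theorem setLIntegral_Ioo_le_tsum {g : ℝ → ℝ≥0∞} (hg : Antitone g) {l t : ℝ} (hl : 0 < l)
    (hl₁ : l < 1) (ht : 0 < t) :
    ∫⁻ u in Ioo 0 t, g u
      ≤ ENNReal.ofReal l⁻¹ * ∑' k : ℕ, ENNReal.ofReal (l ^ (k + 1) * t) * g (l ^ (k + 1) * t) := by
  have hcover : Ioo 0 t ⊆ ⋃ k : ℕ, Ioc (l ^ (k + 1) * t) (l ^ k * t) := by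
    rintro u ⟨hu₀, hut⟩
    obtain ⟨k, hk, hk'⟩ :=
      exists_nat_pow_near_of_lt_one (div_pos hu₀ ht) ((div_le_one ht).2 hut.le) hl hl₁
    exact mem_iUnion.2 ⟨k, (lt_div_iff₀ ht).1 hk, (div_le_iff₀ ht).1 hk'⟩
  have hterm : ∀ k : ℕ, ∫⁻ u in Ioc (l ^ (k + 1) * t) (l ^ k * t), g u
      ≤ ENNReal.ofReal l⁻¹ * (ENNReal.ofReal (l ^ (k + 1) * t) * g (l ^ (k + 1) * t)) := fun k => by
    calc ∫⁻ u in Ioc (l ^ (k + 1) * t) (l ^ k * t), g u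
        ≤ ∫⁻ _ in Ioc (l ^ (k + 1) * t) (l ^ k * t), g (l ^ (k + 1) * t) :=
          setLIntegral_mono' measurableSet_Ioc fun u hu => hg hu.1.le
      _ = ENNReal.ofReal (l ^ k * t - l ^ (k + 1) * t) * g (l ^ (k + 1) * t) := by
          rw [setLIntegral_const, Real.volume_Ioc, mul_comm]
      _ ≤ ENNReal.ofReal (l⁻¹ * (l ^ (k + 1) * t)) * g (l ^ (k + 1) * t) := by
          gcongr
          rw [pow_succ', mul_assoc, inv_mul_cancel_left₀ hl.ne']
          exact sub_le_self _ (by positivity)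
      _ = _ := by rw [ENNReal.ofReal_mul (inv_nonneg.2 hl.le), mul_assoc]
  rw [← ENNReal.tsum_mul_left]
  exact ((lintegral_mono_set hcover).trans (lintegral_iUnion_le _ _)).trans
    (ENNReal.tsum_le_tsum hterm)

theorem IsFunctionQuasinorm.exists_hardy_le (hN : IsFunctionQuasinorm N)
    (hγ : HasUpperBoydIndexLE N γ) (hγ₀ : γ < 0) :
    ∃ C : ℝ≥0, ∀ g : ℝ → ℝ≥0∞, Antitone g →
      N (fun t => ∫⁻ u in Ioo 0 t, g u) ≤ C * N (fun t => ENNReal.ofReal t * g t) := by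
  obtain ⟨l, hl, hl₁, C, hC⟩ := hN.exists_tsum_comp_mul_le hγ hγ₀
  refine ⟨l⁻¹.toNNReal * C, fun g hg => ?_⟩
  refine (hN.mono fun t ht => setLIntegral_Ioo_le_tsum hg hl hl₁ ht).trans
    ((hN.const_mul_le l⁻¹.toNNReal _).trans ?_)
  rw [ENNReal.coe_mul, mul_assoc]
  gcongr
  exact hC (fun t => ENNReal.ofReal t * g t) (ENNReal.measurable_ofReal.mul hg.measurable)

end FunctionQuasinorm

theorem lintegral_coe_le_of_measure_lt_le {α β : Type*} [MeasurableSpace α] [MeasurableSpace β]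
    {μ : Measure α} {ν : Measure β} {g : α → ℝ≥0} {h : β → ℝ≥0∞} (hg : AEMeasurable g μ)
    (hh : AEMeasurable h ν) (hgh : ∀ l : ℝ≥0, μ {x | l < g x} ≤ ν {y | l < h y}) :
    ∫⁻ x, g x ∂μ ≤ ∫⁻ y, h y ∂ν := by
  rcases eq_or_ne (∫⁻ y, h y ∂ν) ∞ with htop | htop
  · exact htop ▸ le_top
  have hfin : ∀ᵐ y ∂ν, h y < ∞ := ae_lt_top' hh htop
  calc ∫⁻ x, g x ∂μ = ∫⁻ x, ENNReal.ofReal (g x) ∂μ := by simp only [ENNReal.ofReal_coe_nnreal]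
    _ = ∫⁻ l in Ioi (0 : ℝ), μ {x | l < g x} :=
        lintegral_eq_lintegral_meas_lt μ (ae_of_all _ fun x => (g x).coe_nonneg)
          hg.coe_nnreal_real
    _ ≤ ∫⁻ l in Ioi (0 : ℝ), ν {y | l < (h y).toReal} := by
        refine setLIntegral_mono' measurableSet_Ioi fun l hl => ?_
        lift l to ℝ≥0 using (mem_Ioi.1 hl).le
        refine (hgh l).trans (measure_mono_ae ?_)
        filter_upwards [hfin] with y hy hly
        exact (ENNReal.toReal_lt_toReal ENNReal.coe_ne_top hy.ne).2 hly
    _ = ∫⁻ y, ENNReal.ofReal (h y).toReal ∂ν :=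
        (lintegral_eq_lintegral_meas_lt ν (ae_of_all _ fun _ => ENNReal.toReal_nonneg)
          hh.ennreal_toReal).symm
    _ ≤ ∫⁻ y, h y ∂ν := lintegral_mono fun _ => ENNReal.ofReal_toReal_le

section Rearrangement

variable {Ω : Type*} [MeasurableSpace Ω] {μ : Measure Ω} {𝕜 : Type*} [RCLike 𝕜]

theorem rearrangement_antitone (f : Ω →ₘ[μ] 𝕜) : Antitone (rearrangement f) := fun _ _ h =>
  sInf_le_sInf fun _ hl => hl.trans (ENNReal.ofReal_le_ofReal h)

theorem measure_rearrangement_lt_le (f : Ω →ₘ[μ] 𝕜) (t : ℝ) :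
    μ {x | rearrangement f t < ‖f x‖ₑ} ≤ ENNReal.ofReal t := by
  set S : Set ℝ≥0∞ := {l | μ {x | l < ‖f x‖ₑ} ≤ ENNReal.ofReal t} with hS
  obtain ⟨u, hu, hlim, huS⟩ :=
    exists_seq_tendsto_sInf (S := S) ⟨∞, by simp [hS]⟩ (OrderBot.bddBelow S)
  have hunion : {x | rearrangement f t < ‖f x‖ₑ} ⊆ ⋃ n, {x | u n < ‖f x‖ₑ} := fun x hx =>
    mem_iUnion.2 (hlim.eventually_lt_const hx).exists
  have hmono : Monotone fun n => {x | u n < ‖f x‖ₑ} := fun i j hij x hx => (hu hij).trans_lt hx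
  refine (measure_mono hunion).trans ?_
  rw [hmono.measure_iUnion]
  exact iSup_le huS

theorem rearrangement_le_iff {f : Ω →ₘ[μ] 𝕜} {t : ℝ} {l : ℝ≥0∞} :
    rearrangement f t ≤ l ↔ μ {x | l < ‖f x‖ₑ} ≤ ENNReal.ofReal t :=
  ⟨fun h => (measure_mono fun _ hx => h.trans_lt hx).trans (measure_rearrangement_lt_le f t),
    fun h => sInf_le h⟩

theorem lt_rearrangement_iff {f : Ω →ₘ[μ] 𝕜} {t : ℝ} {l : ℝ≥0∞} :
    l < rearrangement f t ↔ ENNReal.ofReal t < μ {x | l < ‖f x‖ₑ} := by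
  simpa only [not_le] using rearrangement_le_iff.not

theorem ofReal_mul_rearrangement_le_eLpNorm_one (f : Ω →ₘ[μ] 𝕜) {t : ℝ} (ht : 0 < t) :
    ENNReal.ofReal t * rearrangement f t ≤ eLpNorm f 1 μ := by
  rw [mul_comm, ← ENNReal.le_div_iff_mul_le (Or.inl (by simpa using ht))
    (Or.inl ENNReal.ofReal_ne_top)]
  refine le_of_forall_lt fun l hl => ?_
  obtain ⟨m, hlm, hm⟩ := exists_between hl
  refine hlm.trans_le ?_
  rw [ENNReal.le_div_iff_mul_le (Or.inl (by simpa using ht)) (Or.inl ENNReal.ofReal_ne_top)]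
  calc m * ENNReal.ofReal t ≤ m * μ {x | m ≤ ‖f x‖ₑ} := by
        gcongr
        exact (lt_rearrangement_iff.1 hm).le.trans
          (measure_mono fun x (hx : m < ‖f x‖ₑ) => hx.le)
    _ ≤ ∫⁻ x, ‖f x‖ₑ ∂μ := mul_meas_ge_le_lintegral₀ f.aestronglyMeasurable.enorm m
    _ = eLpNorm f 1 μ := eLpNorm_one_eq_lintegral_enorm.symm

theorem rearrangement_add_le (f g : Ω →ₘ[μ] 𝕜) (t : ℝ) :
    rearrangement (f + g) t ≤ rearrangement f t + eLpNorm g ∞ μ := by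
  refine rearrangement_le_iff.2 ((measure_mono_ae ?_).trans (measure_rearrangement_lt_le f t))
  filter_upwards [AEEqFun.coeFn_add f g, enorm_ae_le_eLpNormEssSup g μ] with x hadd hg hlt
  rw [eLpNorm_exponent_top] at hlt
  change _ < ‖(f + g) x‖ₑ at hlt
  change _ < ‖f x‖ₑ
  rw [hadd, Pi.add_apply] at hlt
  by_contra! hle
  exact ((enorm_add_le _ _).trans (add_le_add hle hg)).not_gt hlt

theorem measure_restrict_lt_le_volume (f : Ω →ₘ[μ] 𝕜) {E : Set Ω} {t : ℝ}
    (hE : μ E ≤ ENNReal.ofReal t) (l : ℝ≥0∞) :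
    μ.restrict E {x | l < ‖f x‖ₑ} ≤ volume.restrict (Ioo 0 t) {u | l < rearrangement f u} := by
  set m : ℝ≥0∞ := μ.restrict E {x | l < ‖f x‖ₑ}
  have hmt : m ≤ ENNReal.ofReal t :=
    (measure_mono (subset_univ _)).trans (by rwa [Measure.restrict_apply_univ])
  have hm : m ≠ ∞ := (hmt.trans_lt ENNReal.ofReal_lt_top).ne
  have hsub : Ioo 0 m.toReal ⊆ {u | l < rearrangement f u} ∩ Ioo 0 t := by
    rintro u ⟨hu₀, hu⟩
    have hum : ENNReal.ofReal u < m := (ENNReal.ofReal_lt_iff_lt_toReal hu₀.le hm).2 hu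
    exact ⟨lt_rearrangement_iff.2 (hum.trans_le (Measure.restrict_apply_le _ _)), hu₀,
      (ENNReal.ofReal_lt_ofReal_iff_of_nonneg hu₀.le).1 (hum.trans_le hmt)⟩
  calc m = volume (Ioo 0 m.toReal) := by rw [Real.volume_Ioo, sub_zero, ENNReal.ofReal_toReal hm]
    _ ≤ volume ({u | l < rearrangement f u} ∩ Ioo 0 t) := measure_mono hsub
    _ ≤ _ := Measure.le_restrict_apply _ _

theorem setLIntegral_enorm_le_setLIntegral_rearrangement (f : Ω →ₘ[μ] 𝕜) {E : Set Ω} {t : ℝ}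
    (hE : μ E ≤ ENNReal.ofReal t) :
    ∫⁻ x in E, ‖f x‖ₑ ∂μ ≤ ∫⁻ u in Ioo 0 t, rearrangement f u :=
  lintegral_coe_le_of_measure_lt_le f.aestronglyMeasurable.restrict.nnnorm.aemeasurable
    (rearrangement_antitone f).measurable.aemeasurable fun l => by
      simpa only [enorm_eq_nnnorm, ENNReal.coe_lt_coe] using measure_restrict_lt_le_volume f hE l

theorem ofReal_mul_maximalRearrangement (f : Ω →ₘ[μ] 𝕜) {t : ℝ} (ht : 0 < t) :
    ENNReal.ofReal t * maximalRearrangement f t = ∫⁻ u in Ioo 0 t, rearrangement f u :=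
  ENNReal.mul_inv_cancel_left (by simpa using ht) ENNReal.ofReal_ne_top

theorem ofReal_mul_rearrangement_le_setLIntegral (f : Ω →ₘ[μ] 𝕜) (t : ℝ) :
    ENNReal.ofReal t * rearrangement f t ≤ ∫⁻ u in Ioo 0 t, rearrangement f u := by
  calc ENNReal.ofReal t * rearrangement f t = ∫⁻ _ in Ioo 0 t, rearrangement f t := by
        rw [setLIntegral_const, Real.volume_Ioo, sub_zero, mul_comm]
    _ ≤ ∫⁻ u in Ioo 0 t, rearrangement f u :=
        setLIntegral_mono' measurableSet_Ioo fun u hu => rearrangement_antitone f hu.2.le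

theorem exists_add_eq_eLpNorm_le (f : Ω →ₘ[μ] 𝕜) (t : ℝ) :
    ∃ f₀ f₁ : Ω →ₘ[μ] 𝕜, f = f₀ + f₁ ∧
      eLpNorm f₀ 1 μ ≤ ∫⁻ u in Ioo 0 t, rearrangement f u ∧
      eLpNorm f₁ ∞ μ ≤ rearrangement f t := by
  set E : Set Ω := {x | rearrangement f t < ‖f x‖ₑ}
  have hEm : MeasurableSet E := measurableSet_lt measurable_const f.stronglyMeasurable.enorm
  have h₀ : AEStronglyMeasurable (E.indicator f) μ := f.aestronglyMeasurable.indicator hEm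
  have h₁ : AEStronglyMeasurable (Eᶜ.indicator f) μ := f.aestronglyMeasurable.indicator hEm.compl
  refine ⟨AEEqFun.mk _ h₀, AEEqFun.mk _ h₁, ?_, ?_, ?_⟩
  · simp only [AEEqFun.mk_add_mk, indicator_self_add_compl, AEEqFun.mk_coeFn]
  · rw [eLpNorm_congr_ae (AEEqFun.coeFn_mk _ h₀), eLpNorm_indicator_eq_eLpNorm_restrict hEm,
      eLpNorm_one_eq_lintegral_enorm]
    exact setLIntegral_enorm_le_setLIntegral_rearrangement f (measure_rearrangement_lt_le f t)
  · rw [eLpNorm_congr_ae (AEEqFun.coeFn_mk _ h₁), eLpNorm_exponent_top]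
    refine eLpNormEssSup_le_of_ae_enorm_bound (ae_of_all _ fun x => ?_)
    by_cases hx : x ∈ E
    · simp [hx]
    · rw [indicator_of_mem (mem_compl hx)]
      exact not_lt.1 hx

end Rearrangement

theorem Space.Embeds.trans {E : Type*} {X Y Z : Space E} (h : X.Embeds Y) (h' : Y.Embeds Z) :
    X.Embeds Z := by
  obtain ⟨hs, C, hC⟩ := h
  obtain ⟨hs', C', hC'⟩ := h'
  refine ⟨hs.trans hs', C' * C, fun f hf => (hC' f (hs hf)).trans ?_⟩
  rw [ENNReal.coe_mul, mul_assoc]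
  gcongr
  exact hC f hf

section Interpolation

variable {E : Type*} [AddCommGroup E] {A₀ A₀' A₁ : Space E} {N : (ℝ → ℝ≥0∞) → ℝ≥0∞}

/-- The space `(A₀, A₁)_N` of the real method with parameter `N`; `interpLL` and `interpRR` are
the cases `N = normLL (-θ) s c r b q a` and `N = normRR (-θ) s c r b q a`. -/
noncomputable def interpSpace (A₀ A₁ : Space E) (N : (ℝ → ℝ≥0∞) → ℝ≥0∞) : Space E where
  elements := {f | f ∈ sumElements A₀ A₁ ∧ N (peetreK A₀ A₁ f) < ∞}
  qnorm f := N (peetreK A₀ A₁ f)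

theorem peetreK_le {f f₀ f₁ : E} (h₀ : f₀ ∈ A₀.elements) (h₁ : f₁ ∈ A₁.elements)
    (h : f = f₀ + f₁) (t : ℝ) :
    peetreK A₀ A₁ f t ≤ A₀.qnorm f₀ + ENNReal.ofReal t * A₁.qnorm f₁ :=
  iInf₂_le_of_le f₀ h₀ <| iInf₂_le_of_le f₁ h₁ <| iInf_le _ h

theorem le_peetreK {f : E} {t : ℝ} {x : ℝ≥0∞}
    (h : ∀ f₀ ∈ A₀.elements, ∀ f₁ ∈ A₁.elements, f = f₀ + f₁ →
      x ≤ A₀.qnorm f₀ + ENNReal.ofReal t * A₁.qnorm f₁) :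
    x ≤ peetreK A₀ A₁ f t :=
  le_iInf₂ fun f₀ h₀ => le_iInf₂ fun f₁ h₁ => le_iInf fun hf => h f₀ h₀ f₁ h₁ hf

theorem Space.Embeds.exists_peetreK_le (h : A₀.Embeds A₀') (A₁ : Space E) :
    ∃ C : ℝ≥0, ∀ f t, peetreK A₀' A₁ f t ≤ C * peetreK A₀ A₁ f t := by
  obtain ⟨hsub, C, hC⟩ := h
  have hD : ((max C 1 : ℝ≥0) : ℝ≥0∞) ≠ 0 := by simp
  refine ⟨max C 1, fun f t => ?_⟩
  rw [mul_comm, ← ENNReal.div_le_iff hD ENNReal.coe_ne_top]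
  refine le_peetreK fun f₀ h₀ f₁ h₁ hf => ?_
  rw [ENNReal.div_le_iff hD ENNReal.coe_ne_top, add_mul, mul_comm (A₀.qnorm f₀)]
  refine (peetreK_le (hsub h₀) h₁ hf t).trans (add_le_add ((hC f₀ h₀).trans ?_) ?_)
  · gcongr
    exact le_max_left C 1
  · exact le_mul_of_one_le_right' (by exact_mod_cast le_max_right C 1)

theorem Space.Embeds.interpSpace_left (h : A₀.Embeds A₀') (A₁ : Space E)
    (hN : IsFunctionQuasinorm N) :
    (interpSpace A₀ A₁ N).Embeds (interpSpace A₀' A₁ N) := by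
  obtain ⟨C, hC⟩ := h.exists_peetreK_le A₁
  have hle : ∀ f, N (peetreK A₀' A₁ f) ≤ C * N (peetreK A₀ A₁ f) := fun f =>
    (hN.mono fun t _ => hC f t).trans (hN.const_mul_le C _)
  refine ⟨?_, C, fun f _ => hle f⟩
  rintro f ⟨⟨f₀, h₀, f₁, h₁, hf⟩, hfin⟩
  exact ⟨⟨f₀, h.1 h₀, f₁, h₁, hf⟩, (hle f).trans_lt (ENNReal.mul_lt_top ENNReal.coe_lt_top hfin)⟩

end Interpolation

section Embeddings

variable {Ω : Type*} [MeasurableSpace Ω] (μ : Measure Ω) (𝕜 : Type*) [RCLike 𝕜]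
  {N : (ℝ → ℝ≥0∞) → ℝ≥0∞} {γ : ℝ}

theorem lebesgueSpace_one_embeds_weakL1 : (lebesgueSpace μ 𝕜 1).Embeds (weakL1 μ 𝕜) := by
  have hle : ∀ f : Ω →ₘ[μ] 𝕜, (weakL1 μ 𝕜).qnorm f ≤ (lebesgueSpace μ 𝕜 1).qnorm f := fun f =>
    iSup₂_le fun _ ht => ofReal_mul_rearrangement_le_eLpNorm_one f ht
  exact ⟨fun f hf => (hle f).trans_lt hf, 1, fun f _ => by simpa using hle f⟩

variable {μ 𝕜}

theorem ofReal_mul_rearrangement_le_peetreK (f : Ω →ₘ[μ] 𝕜) {t : ℝ} (ht : 0 < t) :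
    ENNReal.ofReal t * rearrangement f t
      ≤ peetreK (weakL1 μ 𝕜) (lebesgueSpace μ 𝕜 ∞) f t := by
  refine le_peetreK fun f₀ _ f₁ _ hf => ?_
  calc ENNReal.ofReal t * rearrangement f t
      ≤ ENNReal.ofReal t * (rearrangement f₀ t + eLpNorm f₁ ∞ μ) := by
        gcongr
        exact hf ▸ rearrangement_add_le f₀ f₁ t
    _ ≤ (weakL1 μ 𝕜).qnorm f₀ + ENNReal.ofReal t * eLpNorm f₁ ∞ μ := by
        rw [mul_add]
        gcongr
        exact le_iSup₂ (f := fun (t : ℝ) (_ : 0 < t) => ENNReal.ofReal t * rearrangement f₀ t) t ht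

theorem exists_lebesgueSpace_add_eq (f : Ω →ₘ[μ] 𝕜) {t : ℝ} (ht : 0 < t)
    (hf : ENNReal.ofReal t * maximalRearrangement f t < ∞) :
    ∃ f₀ ∈ (lebesgueSpace μ 𝕜 1).elements, ∃ f₁ ∈ (lebesgueSpace μ 𝕜 ∞).elements, f = f₀ + f₁ ∧
      eLpNorm f₀ 1 μ + ENNReal.ofReal t * eLpNorm f₁ ∞ μ
        ≤ 2 * (ENNReal.ofReal t * maximalRearrangement f t) := by
  rw [ofReal_mul_maximalRearrangement f ht] at hf ⊢
  obtain ⟨f₀, f₁, h, h₀, h₁⟩ := exists_add_eq_eLpNorm_le f t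
  have h₁' : ENNReal.ofReal t * eLpNorm f₁ ∞ μ ≤ ∫⁻ u in Ioo 0 t, rearrangement f u :=
    (mul_le_mul_right h₁ _).trans (ofReal_mul_rearrangement_le_setLIntegral f t)
  refine ⟨f₀, h₀.trans_lt hf, f₁, ?_, h, ?_⟩
  · exact ENNReal.lt_top_of_mul_ne_top_right (h₁'.trans_lt hf).ne (by simpa using ht)
  · rw [two_mul]
    exact add_le_add h₀ h₁'

theorem peetreK_lebesgueSpace_le (f : Ω →ₘ[μ] 𝕜) {t : ℝ} (ht : 0 < t) :
    peetreK (lebesgueSpace μ 𝕜 1) (lebesgueSpace μ 𝕜 ∞) f t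
      ≤ 2 * (ENNReal.ofReal t * maximalRearrangement f t) := by
  rcases eq_top_or_lt_top (ENNReal.ofReal t * maximalRearrangement f t) with h | h
  · simp [h]
  obtain ⟨f₀, h₀, f₁, h₁, hf, hle⟩ := exists_lebesgueSpace_add_eq f ht h
  exact (peetreK_le h₀ h₁ hf t).trans hle

variable (μ 𝕜)

theorem interpSpace_weakL1_embeds (hN : IsFunctionQuasinorm N) :
    (interpSpace (weakL1 μ 𝕜) (lebesgueSpace μ 𝕜 ∞) N).Embeds
      (Space.ofFunctional fun f : Ω →ₘ[μ] 𝕜 =>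
        N fun t => ENNReal.ofReal t * rearrangement f t) := by
  have hle : ∀ f : Ω →ₘ[μ] 𝕜, N (fun t => ENNReal.ofReal t * rearrangement f t)
      ≤ N (peetreK (weakL1 μ 𝕜) (lebesgueSpace μ 𝕜 ∞) f) := fun f =>
    hN.mono fun t ht => ofReal_mul_rearrangement_le_peetreK f ht
  exact ⟨fun f hf => (hle f).trans_lt hf.2, 1, fun f _ => by simpa using! hle f⟩

theorem ofFunctional_rearrangement_embeds (hN : IsFunctionQuasinorm N)
    (hγ : HasUpperBoydIndexLE N γ) (hγ₀ : γ < 0) :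
    (Space.ofFunctional fun f : Ω →ₘ[μ] 𝕜 =>
        N fun t => ENNReal.ofReal t * rearrangement f t).Embeds
      (Space.ofFunctional fun f : Ω →ₘ[μ] 𝕜 =>
        N fun t => ENNReal.ofReal t * maximalRearrangement f t) := by
  obtain ⟨C, hC⟩ := hN.exists_hardy_le hγ hγ₀
  have hle : ∀ f : Ω →ₘ[μ] 𝕜, N (fun t => ENNReal.ofReal t * maximalRearrangement f t)
      ≤ C * N fun t => ENNReal.ofReal t * rearrangement f t := fun f =>
    (hN.mono fun t ht => (ofReal_mul_maximalRearrangement f ht).le).trans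
      (hC _ (rearrangement_antitone f))
  exact ⟨fun f hf => (hle f).trans_lt (ENNReal.mul_lt_top ENNReal.coe_lt_top hf), C,
    fun f _ => hle f⟩

theorem ofFunctional_maximalRearrangement_embeds (hN : IsFunctionQuasinorm N) :
    (Space.ofFunctional fun f : Ω →ₘ[μ] 𝕜 =>
        N fun t => ENNReal.ofReal t * maximalRearrangement f t).Embeds
      (interpSpace (lebesgueSpace μ 𝕜 1) (lebesgueSpace μ 𝕜 ∞) N) := by
  have hle : ∀ f : Ω →ₘ[μ] 𝕜, N (peetreK (lebesgueSpace μ 𝕜 1) (lebesgueSpace μ 𝕜 ∞) f)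
      ≤ (2 : ℝ≥0) * N fun t => ENNReal.ofReal t * maximalRearrangement f t := fun f =>
    (hN.mono fun t ht => peetreK_lebesgueSpace_le f ht).trans (hN.const_mul_le 2 _)
  have hsum : ∀ f : Ω →ₘ[μ] 𝕜, N (fun t => ENNReal.ofReal t * maximalRearrangement f t) < ∞ →
      f ∈ sumElements (lebesgueSpace μ 𝕜 1) (lebesgueSpace μ 𝕜 ∞) := fun f hf => by
    obtain ⟨t, ht, hft⟩ : ∃ t, 0 < t ∧ ENNReal.ofReal t * maximalRearrangement f t < ∞ := by
      by_contra! htop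
      exact (hN.top.symm.trans_le (hN.mono htop)).not_gt hf
    obtain ⟨f₀, h₀, f₁, h₁, h, -⟩ := exists_lebesgueSpace_add_eq f ht hft
    exact ⟨f₀, h₀, f₁, h₁, h⟩
  exact ⟨fun f hf => ⟨hsum f hf, (hle f).trans_lt (ENNReal.mul_lt_top ENNReal.coe_lt_top hf)⟩, 2,
    fun f _ => hle f⟩

theorem interpSpace_same_of_hasUpperBoydIndexLE (hN : IsFunctionQuasinorm N)
    (hγ : HasUpperBoydIndexLE N γ) (hγ₀ : γ < 0) :
    (interpSpace (lebesgueSpace μ 𝕜 1) (lebesgueSpace μ 𝕜 ∞) N).Same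
        (interpSpace (weakL1 μ 𝕜) (lebesgueSpace μ 𝕜 ∞) N) ∧
      (interpSpace (weakL1 μ 𝕜) (lebesgueSpace μ 𝕜 ∞) N).Same
        (Space.ofFunctional fun f : Ω →ₘ[μ] 𝕜 =>
          N fun t => ENNReal.ofReal t * maximalRearrangement f t) ∧
      (Space.ofFunctional fun f : Ω →ₘ[μ] 𝕜 =>
          N fun t => ENNReal.ofReal t * maximalRearrangement f t).Same
        (Space.ofFunctional fun f : Ω →ₘ[μ] 𝕜 =>
          N fun t => ENNReal.ofReal t * rearrangement f t) := by
  have hweak := (lebesgueSpace_one_embeds_weakL1 μ 𝕜).interpSpace_left (lebesgueSpace μ 𝕜 ∞) hN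
  have hstar := interpSpace_weakL1_embeds μ 𝕜 hN
  have hmax := ofFunctional_rearrangement_embeds μ 𝕜 hN hγ hγ₀
  have hK := ofFunctional_maximalRearrangement_embeds μ 𝕜 hN
  exact ⟨⟨hweak, (hstar.trans hmax).trans hK⟩, ⟨hstar.trans hmax, hK.trans hweak⟩,
    ⟨(hK.trans hweak).trans hstar, hmax⟩⟩

end Embeddings

section NestedNorm

variable {J : ℝ → Set ℝ} {γ : ℝ} {q r s : ℝ≥0∞} {a b c : ℝ → ℝ}

/-- The common form of `normLL` (`J = Ioo 0`) and `normRR` (`J = Ioi`). -/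
noncomputable def nestedNorm (J : ℝ → Set ℝ) (γ : ℝ) (s : ℝ≥0∞) (c : ℝ → ℝ) (r : ℝ≥0∞)
    (b : ℝ → ℝ) (q : ℝ≥0∞) (a : ℝ → ℝ) (g : ℝ → ℝ≥0∞) : ℝ≥0∞ :=
  weightedNorm 0 c s (Ioi 0) fun t =>
    weightedNorm 0 b r (J t) fun u => weightedNorm γ a q (J u) g

theorem IsDilationFamily.isFunctionQuasinorm_nestedNorm (hJ : IsDilationFamily J) (hq : 0 < q)
    (hr : 0 < r) (hs : 0 < s) (ha : SlowlyVarying a) (hb : SlowlyVarying b)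
    (hc : SlowlyVarying c) : IsFunctionQuasinorm (nestedNorm J γ s c r b q a) :=
  ((isFunctionQuasinorm_weightedNorm hs hc).comp_weightedNorm hJ hr hb).comp_weightedNorm hJ hq ha

theorem IsDilationFamily.hasUpperBoydIndexLE_nestedNorm (hJ : IsDilationFamily J)
    (hr : 0 < r) (hs : 0 < s) (ha : SlowlyVarying a) (hb : SlowlyVarying b)
    (hc : SlowlyVarying c) : HasUpperBoydIndexLE (nestedNorm J γ s c r b q a) γ := by
  have hN := isFunctionQuasinorm_weightedNorm (γ := 0) hs hc
  have hγ := ((hasUpperBoydIndexLE_weightedNorm (γ := 0) hc).comp_weightedNorm (γ := 0) hN hJ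
    hb).comp_weightedNorm (γ := γ) (q := q) (hN.comp_weightedNorm hJ hr hb) hJ ha
  simp only [zero_add] at hγ
  exact hγ

theorem IsDilationFamily.nestedNorm_ofReal_mul (hJ : IsDilationFamily J) (g : ℝ → ℝ≥0∞) :
    nestedNorm J γ s c r b q a (fun t => ENNReal.ofReal t * g t)
      = nestedNorm J (γ + 1) s c r b q a g :=
  weightedNorm_congr measurableSet_Ioi fun t ht =>
    weightedNorm_congr (hJ.measurableSet t) fun u hu =>
      weightedNorm_ofReal_mul (hJ.measurableSet u) (hJ.subset_Ioi u (hJ.subset_Ioi t ht hu)) g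

end NestedNorm

end LorentzKaramata

open LorentzKaramata in
theorem theorem6p5_general {Ω : Type*} [MeasurableSpace Ω] (μ : Measure Ω) (𝕜 : Type*) [RCLike 𝕜]
    (θ : ℝ) (hθ₀ : 0 < θ) (hθ₁ : θ ≤ 1) (p : ℝ≥0∞) (hp : p = 1 / ENNReal.ofReal (1 - θ))
    (q r s : ℝ≥0∞) (hq : 0 < q) (hr : 0 < r) (hs : 0 < s)
    (a b c : ℝ → ℝ) (ha : SlowlyVarying a) (hb : SlowlyVarying b) (hc : SlowlyVarying c) :
    ((interpLL (lebesgueSpace μ 𝕜 1) (lebesgueSpace μ 𝕜 ∞) θ s c r b q a).Same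
        (interpLL (weakL1 μ 𝕜) (lebesgueSpace μ 𝕜 ∞) θ s c r b q a) ∧
      (interpLL (weakL1 μ 𝕜) (lebesgueSpace μ 𝕜 ∞) θ s c r b q a).Same
        (lorentzMaxLL μ 𝕜 p s c r b q a) ∧
      (lorentzMaxLL μ 𝕜 p s c r b q a).Same (lorentzLL μ 𝕜 p s c r b q a)) ∧
    ((interpRR (lebesgueSpace μ 𝕜 1) (lebesgueSpace μ 𝕜 ∞) θ s c r b q a).Same
        (interpRR (weakL1 μ 𝕜) (lebesgueSpace μ 𝕜 ∞) θ s c r b q a) ∧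
      (interpRR (weakL1 μ 𝕜) (lebesgueSpace μ 𝕜 ∞) θ s c r b q a).Same
        (lorentzMaxRR μ 𝕜 p s c r b q a) ∧
      (lorentzMaxRR μ 𝕜 p s c r b q a).Same (lorentzRR μ 𝕜 p s c r b q a)) := by
  have hp' : (p⁻¹).toReal = -θ + 1 := by
    rw [hp, one_div, inv_inv, ENNReal.toReal_ofReal (by linarith), neg_add_eq_sub]
  have hLL := interpSpace_same_of_hasUpperBoydIndexLE μ 𝕜
    (isDilationFamily_Ioo.isFunctionQuasinorm_nestedNorm hq hr hs ha hb hc)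
    (isDilationFamily_Ioo.hasUpperBoydIndexLE_nestedNorm hr hs ha hb hc) (neg_lt_zero.2 hθ₀)
  have hRR := interpSpace_same_of_hasUpperBoydIndexLE μ 𝕜
    (isDilationFamily_Ioi.isFunctionQuasinorm_nestedNorm hq hr hs ha hb hc)
    (isDilationFamily_Ioi.hasUpperBoydIndexLE_nestedNorm hr hs ha hb hc) (neg_lt_zero.2 hθ₀)
  simp only [isDilationFamily_Ioo.nestedNorm_ofReal_mul, ← hp'] at hLL
  simp only [isDilationFamily_Ioi.nestedNorm_ofReal_mul, ← hp'] at hRR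
  exact ⟨hLL, hRR⟩

theorem theorem6p5 {Ω : Type*} [MeasurableSpace Ω] (μ : Measure Ω) [SigmaFinite μ]
    (hμ : LorentzKaramata.Nonatomic μ) (𝕜 : Type*) [RCLike 𝕜]
    (θ : ℝ) (hθ₀ : 0 < θ) (hθ₁ : θ ≤ 1) (p : ℝ≥0∞) (hp : p = 1 / ENNReal.ofReal (1 - θ))
    (q r s : ℝ≥0∞) (hq : 0 < q) (hr : 0 < r) (hs : 0 < s)
    (a b c : ℝ → ℝ) (ha : LorentzKaramata.SlowlyVarying a)
    (hb : LorentzKaramata.SlowlyVarying b) (hc : LorentzKaramata.SlowlyVarying c) :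
    ((LorentzKaramata.interpLL (LorentzKaramata.lebesgueSpace μ 𝕜 1)
          (LorentzKaramata.lebesgueSpace μ 𝕜 ∞) θ s c r b q a).Same
        (LorentzKaramata.interpLL (LorentzKaramata.weakL1 μ 𝕜)
          (LorentzKaramata.lebesgueSpace μ 𝕜 ∞) θ s c r b q a) ∧
      (LorentzKaramata.interpLL (LorentzKaramata.weakL1 μ 𝕜)
          (LorentzKaramata.lebesgueSpace μ 𝕜 ∞) θ s c r b q a).Same
        (LorentzKaramata.lorentzMaxLL μ 𝕜 p s c r b q a) ∧
      (LorentzKaramata.lorentzMaxLL μ 𝕜 p s c r b q a).Same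
        (LorentzKaramata.lorentzLL μ 𝕜 p s c r b q a)) ∧
    ((LorentzKaramata.interpRR (LorentzKaramata.lebesgueSpace μ 𝕜 1)
          (LorentzKaramata.lebesgueSpace μ 𝕜 ∞) θ s c r b q a).Same
        (LorentzKaramata.interpRR (LorentzKaramata.weakL1 μ 𝕜)
          (LorentzKaramata.lebesgueSpace μ 𝕜 ∞) θ s c r b q a) ∧
      (LorentzKaramata.interpRR (LorentzKaramata.weakL1 μ 𝕜)
          (LorentzKaramata.lebesgueSpace μ 𝕜 ∞) θ s c r b q a).Same
        (LorentzKaramata.lorentzMaxRR μ 𝕜 p s c r b q a) ∧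
      (LorentzKaramata.lorentzMaxRR μ 𝕜 p s c r b q a).Same
        (LorentzKaramata.lorentzRR μ 𝕜 p s c r b q a)) :=
  theorem6p5_general μ 𝕜 θ hθ₀ hθ₁ p hp q r s hq hr hs a b c ha hb hc
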